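/- A \emph{tropical curve} $\Gamma$ is the space underlying a finite connected nonempty multigraph (loops allowed) with a length function on the edges with values in $\mathbb{R}_{>0}\cup\{\infty\}$, where only leaf edges may have length $\infty$; each edge $e$ is identified with $[0,l(e)]$, and for $l(e)=\infty$ a leaf end of $e$ is identified with $\infty$. It carries the quotient topology and the shortest-path distance, and $\Gamma_\infty$ is the finite set of points identified with $\infty$ (at infinite distance from all other points). A pair (graph, length function) giving rise to $\Gamma$ is called a model of $\Gamma$. A \emph{rational function} on $\Gamma$ is either the constant $-\infty$ or a continuous map $f:\Gamma\to\mathbb{R}\cup\{\pm\infty\}$ that is piecewise affine with integer slopes and finitely many pieces and takes the values $\pm\infty$ only at points of $\Gamma_\infty$. The set $\operatorname{Rat}(\Gamma)$ of rational functions is a semifield with addition $f\oplus g=\max\{f,g\}$ and multiplication $f\odot g=f+g$, computed pointwise outside $\Gamma_\infty$ and extended continuously to $\Gamma_\infty$. A continuous map $\varphi:\Gamma\to\Gamma'$ between tropical curves is a \emph{finite harmonic morphism} if there are loopless models of $\Gamma$ and $\Gamma'$ such that $\varphi$ maps vertices to vertices and edges onto edges, for every edge $e$ there is a positive integer $\deg_e(\varphi)$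 with $\operatorname{dist}(\varphi(x),\varphi(y))=\deg_e(\varphi)\operatorname{dist}(x,y)$ for all $x,y\in e$, and for every vertex $v$ of $\Gamma$ the sum of $\deg_e(\varphi)$ over the edges $e\ni v$ with $\varphi(e)=e'$ is the same for all edges $e'$ incident to $\varphi(v)$. Put $\varphi^*(\operatorname{Rat}(\Gamma'))=\{f'\circ\varphi : f'\in\operatorname{Rat}(\Gamma')\}\subset\operatorname{Rat}(\Gamma)$. A finite group $G$ \emph{acts isometrically} on $\Gamma$ if it acts by continuous maps that preserve distances on $\Gamma\setminus\Gamma_\infty$; it then acts on $\operatorname{Rat}(\Gamma)$ by semiring automorphisms, $(g\cdot f)(x)=f(g^{-1}x)$. An action of a finite group $G$ on a semifield $T$ by semiring automorphisms is \emph{Galois} for a semifield extension $T/S$ (with $S\subset T$) if (1) the subsemifield $T^G$ of $G$-invariant elements equals $S$, and (2) any two subgroups $H_1,H_2$ of $G$ with $T^{H_1}=T^{H_2}$ are equal. \textbf{Corollary.} Let $\varphi:\Gamma\to\Gamma'$ be a finite harmonic morphism between tropical curves and let $G$ be a finite group acting isometrically on $\Gamma$. Then the following are equivalent: (a) $\operatorname{Rat}(\Gamma)^G=\varphi^*(\operatorname{Rat}(\Gamma'))$,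 and for every subgroup $H$ of $G$ there exists $f\in\operatorname{Rat}(\Gamma)$ whose stabilizer subgroup in $G$ is $H$; (b) the natural action of $G$ on $\operatorname{Rat}(\Gamma)$ is Galois for $\operatorname{Rat}(\Gamma)/\varphi^*(\operatorname{Rat}(\Gamma'))$. -/

import Mathlib

open scoped ENNReal NNReal Topology

/-- The distance of two points of the extended half-line `[0, ∞]`
(so `∞` is at distance `∞` from every other point and at distance `0` from itself). -/
noncomputable def segDist (s t : ℝ≥0∞) : ℝ≥0∞ := (s - t) + (t - s)

/-- `ChainLength len chart x y r`: there is a path from `x` to `y` of length `r` which is a finite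
concatenation of segments, each one contained in a single edge. Edge `e` is the image of the
interval `[0, len e]` under `chart e`. -/
inductive ChainLength {Γ E : Type*} (len : E → ℝ≥0∞) (chart : E → ℝ≥0∞ → Γ) (x : Γ) :
    Γ → ℝ≥0∞ → Prop
  | refl : ChainLength len chart x x 0
  | step (e : E) (s t r : ℝ≥0∞) (hs : s ≤ len e) (ht : t ≤ len e)
      (h : ChainLength len chart x (chart e s) r) :
      ChainLength len chart x (chart e t) (r + segDist s t)

/-- A model `(G, l)` for the space `Γ` with its distance function: a finite multigraph with vertex
set `verts` and edge set `Edge`, a length function `len` with values in `(0, ∞]`, and an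
identification `chart e` of each edge `e` with the interval `[0, len e]`; the values of `chart e`
outside this interval are irrelevant. The space is the topological gluing of the vertices and the
intervals, and the distance is the length of a shortest path. -/
structure TropicalModel (Γ : Type*) [TopologicalSpace Γ] [EDist Γ] where
  verts : Set Γ
  finite_verts : verts.Finite
  Edge : Type
  finite_edge : Finite Edge
  len : Edge → ℝ≥0∞
  len_pos : ∀ e, 0 < len e
  chart : Edge → ℝ≥0∞ → Γ
  chart_zero_mem : ∀ e, chart e 0 ∈ verts
  chart_len_mem : ∀ e, chart e (len e) ∈ verts
  chart_not_mem : ∀ e s, 0 < s → s < len e → chart e s ∉ verts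
  chart_inj : ∀ e e' s s', 0 < s → s < len e → 0 < s' → s' < len e' →
    chart e s = chart e' s' → e = e' ∧ s = s'
  cover : ∀ x, x ∈ verts ∨ ∃ e s, 0 < s ∧ s < len e ∧ chart e s = x
  /-- an edge of length `∞` is a leaf edge, and its leaf end is the point with parameter `∞` -/
  leaf : ∀ e, len e = ∞ → ∀ e' s, s ≤ len e' → chart e' s = chart e ∞ → e' = e ∧ s = ∞
  /-- the topology is the quotient topology of the gluing -/
  isOpen_iff : ∀ U : Set Γ, IsOpen U ↔ ∀ e, IsOpen {s : Set.Iic (len e) | chart e s ∈ U}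
  edist_eq : ∀ x y, edist x y = sInf {r | ChainLength len chart x y r}

/-- A tropical curve: a connected nonempty space with a distance function which is obtained from
some finite graph with lengths. -/
class IsTropicalCurve (Γ : Type*) [TopologicalSpace Γ] [EDist Γ] : Prop
    extends ConnectedSpace Γ where
  exists_model : Nonempty (TropicalModel Γ)

/-- `Γ_∞`, the set of points at infinity: the points identified with `∞` in a model. -/
def pointsAtInfinity (Γ : Type*) [TopologicalSpace Γ] [EDist Γ] : Set Γ :=
  {x | ∃ (M : TropicalModel Γ) (e : M.Edge), M.len e = ∞ ∧ M.chart e ∞ = x}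

namespace TropicalModel

variable {Γ : Type*} [TopologicalSpace Γ] [EDist Γ]

/-- The closed subset of `Γ` corresponding to the edge `e`. -/
def edgeSet (M : TropicalModel Γ) (e : M.Edge) : Set Γ := M.chart e '' Set.Iic (M.len e)

/-- The graph of the model has no loops. -/
def Loopless (M : TropicalModel Γ) : Prop := ∀ e, M.chart e 0 ≠ M.chart e (M.len e)

theorem chart_ne (M : TropicalModel Γ) {e : M.Edge} {s t : ℝ≥0∞} (hs : s ≤ M.len e)
    (ht0 : 0 < t) (ht : t < M.len e) (hst : s ≠ t) : M.chart e t ≠ M.chart e s := by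
  intro h
  rcases eq_or_lt_of_le (zero_le (a := s)) with h0 | h0
  · exact M.chart_not_mem e t ht0 ht (h ▸ h0 ▸ M.chart_zero_mem e)
  rcases eq_or_lt_of_le hs with h1 | h1
  · exact M.chart_not_mem e t ht0 ht (h ▸ h1 ▸ M.chart_len_mem e)
  · exact hst (M.chart_inj e e t s ht0 ht h0 h1 h).2.symm

theorem edist_chart_le (M : TropicalModel Γ) {e : M.Edge} {s t : ℝ≥0∞} (hs : s ≤ M.len e)
    (ht : t ≤ M.len e) : edist (M.chart e s) (M.chart e t) ≤ segDist s t := by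
  rw [M.edist_eq]
  refine sInf_le ?_
  have := ChainLength.step (len := M.len) (chart := M.chart) e s t 0 hs ht ChainLength.refl
  simpa using this

theorem edist_self (M : TropicalModel Γ) (x : Γ) : edist x x = 0 := by
  rw [M.edist_eq]
  exact le_antisymm (sInf_le ChainLength.refl) (zero_le)

theorem segDist_top_left {t : ℝ≥0∞} (h : t ≠ ∞) : segDist ∞ t = ∞ := by
  simp [segDist, h]

theorem segDist_top_right {t : ℝ≥0∞} (h : t ≠ ∞) : segDist t ∞ = ∞ := by
  simp [segDist, h]

theorem segDist_ne_top {s t : ℝ≥0∞} (hs : s ≠ ∞) (ht : t ≠ ∞) : segDist s t ≠ ∞ := by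
  simp [segDist, hs, ht]

theorem edist_top_left (M : TropicalModel Γ) {e : M.Edge} (he : M.len e = ∞) {y : Γ}
    (hy : y ≠ M.chart e ∞) : edist (M.chart e ∞) y = ∞ := by
  rw [M.edist_eq]
  refine sInf_eq_top.2 fun r hr => ?_
  induction hr with
  | refl => exact absurd rfl hy
  | step e' s t r hs ht h ih =>
    by_cases h1 : M.chart e' s = M.chart e ∞
    · obtain ⟨rfl, rfl⟩ := M.leaf e he e' s hs h1
      rw [segDist_top_left (fun h2 => hy (by rw [h2]))]
      simp
    · simp [ih h1]

theorem edist_top_right (M : TropicalModel Γ) {e : M.Edge} (he : M.len e = ∞) {x : Γ}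
    (hx : x ≠ M.chart e ∞) : edist x (M.chart e ∞) = ∞ := by
  rw [M.edist_eq]
  have key : ∀ y r, ChainLength M.len M.chart x y r → y = M.chart e ∞ → r = ∞ := by
    intro y r hr
    induction hr with
    | refl => exact fun h => absurd h hx
    | step e' s t r hs ht h ih =>
      intro h1
      obtain ⟨rfl, rfl⟩ := M.leaf e he e' t ht h1
      by_cases h2 : s = ∞
      · simp [ih (by rw [h2])]
      · simp [segDist_top_right h2]
  exact sInf_eq_top.2 fun r hr => key _ r hr rfl

theorem exists_edge [ConnectedSpace Γ] [Nontrivial Γ] (M : TropicalModel Γ) (x : Γ) :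
    ∃ e s, s ≤ M.len e ∧ M.chart e s = x := by
  by_contra! hcon
  have h1 : IsOpen ({x} : Set Γ) := by
    rw [M.isOpen_iff]
    intro e
    convert isOpen_empty
    ext s
    simpa using hcon e s s.2
  have h2 : IsOpen ({x}ᶜ : Set Γ) := by
    rw [M.isOpen_iff]
    intro e
    convert isOpen_univ
    ext s
    simpa using hcon e s s.2
  have h3 : IsClopen ({x} : Set Γ) := ⟨⟨h2⟩, h1⟩
  rcases isClopen_iff.1 h3 with h | h
  · exact (Set.singleton_ne_empty x) h
  · obtain ⟨y, hy⟩ := exists_ne x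
    exact hy (by have : y ∈ ({x} : Set Γ) := h ▸ Set.mem_univ y
                 simpa using this)

/-- A point that is not the infinite end of an edge of `M` has another such point at finite
distance, unless the curve is a point. -/
theorem exists_near [ConnectedSpace Γ] [Nontrivial Γ] (M : TropicalModel Γ) {x : Γ}
    (hx : ∀ e, M.len e = ∞ → M.chart e ∞ ≠ x) :
    ∃ y, y ≠ x ∧ (∀ e, M.len e = ∞ → M.chart e ∞ ≠ y) ∧ edist x y ≠ ∞ := by
  obtain ⟨e, s, hs, rfl⟩ := M.exists_edge x
  have hs' : s ≠ ∞ := by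
    rintro rfl
    exact hx e (top_le_iff.1 hs) rfl
  obtain ⟨t, ht0, ht, hts⟩ : ∃ t, 0 < t ∧ t < M.len e ∧ s ≠ t := by
    obtain ⟨a, ha0, ha⟩ := exists_between (M.len_pos e)
    obtain ⟨b, hb0, hb⟩ := exists_between ha
    by_cases h : s = a
    · exact ⟨b, ha0.trans hb0, hb, h ▸ hb0.ne⟩
    · exact ⟨a, ha0, ha, h⟩
  refine ⟨M.chart e t, M.chart_ne hs ht0 ht hts, ?_, ?_⟩
  · intro e' he' h
    exact ht.ne_top (M.leaf e' he' e t ht.le h.symm).2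
  · exact ne_top_of_le_ne_top (segDist_ne_top hs' ht.ne_top) (M.edist_chart_le hs ht.le)

theorem mem_pointsAtInfinity_iff [ConnectedSpace Γ] (M : TropicalModel Γ) {x : Γ} :
    x ∈ pointsAtInfinity Γ ↔ ∃ e, M.len e = ∞ ∧ M.chart e ∞ = x := by
  refine ⟨?_, fun ⟨e, he, h⟩ => ⟨M, e, he, h⟩⟩
  rintro ⟨N, e, he, rfl⟩
  by_contra! hcon
  have : Nontrivial Γ := ⟨⟨N.chart e 0, N.chart e ∞, fun h => by
    have := (N.leaf e he e 0 (zero_le) h).2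
    simp at this⟩⟩
  obtain ⟨y, hy, -, hd⟩ := M.exists_near hcon
  exact hd (N.edist_top_left he hy)

theorem chart_not_mem_infinity [ConnectedSpace Γ] (M : TropicalModel Γ) {e : M.Edge} {s : ℝ≥0∞}
    (hs : s ≤ M.len e) (hs' : s ≠ ∞) : M.chart e s ∉ pointsAtInfinity Γ := by
  rw [M.mem_pointsAtInfinity_iff]
  rintro ⟨e', he', h⟩
  exact hs' (M.leaf e' he' e s hs h.symm).2

theorem nhds_infinity [ConnectedSpace Γ] (M : TropicalModel Γ) {e : M.Edge} (he : M.len e = ∞) :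
    𝓝[(pointsAtInfinity Γ)ᶜ] (M.chart e ∞) ≤
      Filter.map (fun s : ℝ≥0 => M.chart e s) Filter.atTop := by
  intro W hW
  obtain ⟨a, ha⟩ := Filter.mem_atTop_sets.1 (Filter.mem_map.1 hW)
  set O : Set Γ := M.chart e '' Set.Ioi (a : ℝ≥0∞) with hO
  have hopen : IsOpen O := by
    rw [M.isOpen_iff]
    intro e'
    have hpos : ∀ s : ℝ≥0∞, (a : ℝ≥0∞) < s → 0 < s := fun s h => (zero_le).trans_lt h
    have key : ∀ s : ℝ≥0∞, s ≤ M.len e' → (M.chart e' s ∈ O ↔ e' = e ∧ (a : ℝ≥0∞) < s) := by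
      intro s hs
      constructor
      · rintro ⟨t, ht, h⟩
        rw [Set.mem_Ioi] at ht
        by_cases htt : t = ∞
        · subst htt
          obtain ⟨rfl, rfl⟩ := M.leaf e he e' s hs h.symm
          exact ⟨rfl, ht⟩
        have htl : t < M.len e := he ▸ lt_top_iff_ne_top.2 htt
        have hv := M.chart_not_mem e t (hpos t ht) htl
        have hs0 : 0 < s := by
          rcases eq_or_lt_of_le (zero_le (a := s)) with h0 | h0
          · exact absurd (h ▸ h0 ▸ M.chart_zero_mem e') hv
          · exact h0
        have hs1 : s < M.len e' := by
          rcases eq_or_lt_of_le hs with h0 | h0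
          · exact absurd (h ▸ h0 ▸ M.chart_len_mem e') hv
          · exact h0
        obtain ⟨h1, h2⟩ := M.chart_inj e e' t s (hpos t ht) htl hs0 hs1 h
        exact ⟨h1.symm, h2 ▸ ht⟩
      · rintro ⟨rfl, h⟩
        exact ⟨s, h, rfl⟩
    by_cases hee : e' = e
    · have : {s : Set.Iic (M.len e') | M.chart e' s ∈ O} =
          Subtype.val ⁻¹' (Set.Ioi (a : ℝ≥0∞)) := by
        ext s
        have := key s s.2
        simpa [hee] using this
      rw [this]
      exact isOpen_Ioi.preimage continuous_subtype_val
    · have : {s : Set.Iic (M.len e') | M.chart e' s ∈ O} = ∅ := by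
        ext s
        have := key s s.2
        simpa [hee] using this
      rw [this]
      exact isOpen_empty
  refine mem_nhdsWithin.2 ⟨O, hopen, ⟨∞, by simp, rfl⟩, ?_⟩
  rintro x ⟨⟨t, ht, rfl⟩, hx⟩
  have htt : t ≠ ∞ := by
    rintro rfl
    exact hx ⟨M, e, he, rfl⟩
  lift t to ℝ≥0 using htt
  exact ha t (by
    rw [Set.mem_Ioi, ENNReal.coe_lt_coe] at ht
    exact ht.le)

theorem tendsto_infinity (M : TropicalModel Γ) {e : M.Edge} (he : M.len e = ∞) :
    Filter.Tendsto (fun s : ℝ≥0 => M.chart e s) Filter.atTop (𝓝 (M.chart e ∞)) := by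
  intro W hW
  obtain ⟨U, hUW, hU, hxU⟩ := mem_nhds_iff.1 hW
  have h1 := (M.isOpen_iff U).1 hU e
  have h2 : Filter.Tendsto (fun s : ℝ≥0 => (⟨(s : ℝ≥0∞), by simp [he]⟩ : Set.Iic (M.len e)))
      Filter.atTop (𝓝 ⟨∞, by simp [he]⟩) := by
    rw [tendsto_subtype_rng]
    exact ENNReal.tendsto_coe_nhds_top.2 Filter.tendsto_id
  filter_upwards [h2 (h1.mem_nhds hxU)] with s hs
  exact hUW hs

theorem dense_finite [ConnectedSpace Γ] (M : TropicalModel Γ) :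
    Dense ((pointsAtInfinity Γ)ᶜ : Set Γ) := by
  intro x
  by_cases hx : x ∈ pointsAtInfinity Γ
  · obtain ⟨e, he, rfl⟩ := M.mem_pointsAtInfinity_iff.1 hx
    exact mem_closure_of_tendsto (M.tendsto_infinity he)
      (Filter.Eventually.of_forall fun s => M.chart_not_mem_infinity (by simp [he]) (by simp))
  · exact subset_closure hx

/-- The image of a model under a self-homeomorphism that preserves the distance. -/
def map (M : TropicalModel Γ) (h : Γ ≃ₜ Γ) (hd : ∀ x y, edist (h x) (h y) = edist x y) :
    TropicalModel Γ where
  verts := h '' M.verts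
  finite_verts := M.finite_verts.image h
  Edge := M.Edge
  finite_edge := M.finite_edge
  len := M.len
  len_pos := M.len_pos
  chart e s := h (M.chart e s)
  chart_zero_mem e := ⟨_, M.chart_zero_mem e, rfl⟩
  chart_len_mem e := ⟨_, M.chart_len_mem e, rfl⟩
  chart_not_mem e s h0 h1 := by
    rintro ⟨v, hv, hh⟩
    exact M.chart_not_mem e s h0 h1 (h.injective hh ▸ hv)
  chart_inj e e' s s' a b c d hh := M.chart_inj e e' s s' a b c d (h.injective hh)
  cover x := by
    rcases M.cover (h.symm x) with hx | ⟨e, s, h0, h1, hh⟩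
    · exact Or.inl ⟨_, hx, by simp⟩
    · exact Or.inr ⟨e, s, h0, h1, by simp [hh]⟩
  leaf e he e' s hs hh := M.leaf e he e' s hs (h.injective hh)
  isOpen_iff U := by
    rw [← h.isOpen_preimage, M.isOpen_iff]
    rfl
  edist_eq x y := by
    have push : ∀ (k : Γ ≃ₜ Γ) (c : M.Edge → ℝ≥0∞ → Γ) (x y : Γ) (r : ℝ≥0∞),
        ChainLength M.len c x y r → ChainLength M.len (fun e s => k (c e s)) (k x) (k y) r := by
      intro k c x y r hr
      induction hr with
      | refl => exact ChainLength.refl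
      | step e s t r hs ht _ ih =>
        exact ChainLength.step (chart := fun e s => k (c e s)) e s t r hs ht ih
    have h1 : edist x y = edist (h.symm x) (h.symm y) := by
      rw [← hd (h.symm x)]; simp
    rw [h1, M.edist_eq]
    congr 1
    ext r
    constructor
    · intro hr
      simpa using push h _ _ _ _ hr
    · intro hr
      simpa using push h.symm _ _ _ _ hr

end TropicalModel

/-- `h`, restricted to the finite points of the interval `[0, L]`, is piecewise affine with integer
slopes and finitely many pieces: apart from finitely many break points, it is affine with an integer
slope on every interval which contains no break point. -/
def IsPiecewiseAffine (L : ℝ≥0∞) (h : ℝ≥0 → EReal) : Prop :=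
  ∃ B : Finset ℝ≥0, ∀ J : Set ℝ≥0, J.OrdConnected → (∀ s ∈ J, (s : ℝ≥0∞) ≤ L) →
    (∀ s ∈ J, s ∉ B) → ∃ (n : ℤ) (c : ℝ), ∀ s ∈ J, h s = ((n * s + c : ℝ) : EReal)

/-- A rational function on a tropical curve: a continuous function with values in `[-∞, ∞]` which
is either constantly `-∞`, or takes infinite values only at points at infinity and is piecewise
affine with integer slopes and finitely many pieces on the edges of models. -/
def IsRationalFunction {Γ : Type*} [TopologicalSpace Γ] [EDist Γ] (f : Γ → EReal) : Prop :=
  Continuous f ∧ ((∀ x, f x = ⊥) ∨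
    ((∀ x ∉ pointsAtInfinity Γ, f x ≠ ⊥ ∧ f x ≠ ⊤) ∧
      ∀ (M : TropicalModel Γ) (e : M.Edge),
        IsPiecewiseAffine (M.len e) (fun s => f (M.chart e s))))

/-- `Rat(Γ)`, the set of rational functions on `Γ`. -/
structure RatFun (Γ : Type*) [TopologicalSpace Γ] [EDist Γ] where
  toFun : Γ → EReal
  isRational : IsRationalFunction toFun

namespace IsPiecewiseAffine

variable {L : ℝ≥0∞} {h k : ℝ≥0 → EReal}

theorem const (c : ℝ) : IsPiecewiseAffine L (fun _ => (c : EReal)) :=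
  ⟨∅, fun _ _ _ _ => ⟨0, c, by simp⟩⟩

theorem congr (hh : IsPiecewiseAffine L h) (hk : ∀ s : ℝ≥0, (s : ℝ≥0∞) ≤ L → k s = h s) :
    IsPiecewiseAffine L k := by
  obtain ⟨B, hB⟩ := hh
  refine ⟨B, fun J h1 h2 h3 => ?_⟩
  obtain ⟨n, c, hn⟩ := hB J h1 h2 h3
  exact ⟨n, c, fun s hs => by rw [hk s (h2 s hs), hn s hs]⟩

theorem neg (hh : IsPiecewiseAffine L h) : IsPiecewiseAffine L (fun s => - h s) := by
  obtain ⟨B, hB⟩ := hh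
  refine ⟨B, fun J h1 h2 h3 => ?_⟩
  obtain ⟨n, c, hn⟩ := hB J h1 h2 h3
  refine ⟨-n, -c, fun s hs => ?_⟩
  change - h s = _
  rw [hn s hs, ← EReal.coe_neg]
  congr 1
  push_cast
  ring

theorem add (hh : IsPiecewiseAffine L h) (hk : IsPiecewiseAffine L k) :
    IsPiecewiseAffine L (fun s => h s + k s) := by
  obtain ⟨B, hB⟩ := hh
  obtain ⟨C, hC⟩ := hk
  refine ⟨B ∪ C, fun J h1 h2 h3 => ?_⟩
  obtain ⟨n, c, hn⟩ := hB J h1 h2 (fun s hs hb => h3 s hs (Finset.mem_union_left _ hb))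
  obtain ⟨m, d, hm⟩ := hC J h1 h2 (fun s hs hb => h3 s hs (Finset.mem_union_right _ hb))
  refine ⟨n + m, c + d, fun s hs => ?_⟩
  change h s + k s = _
  rw [hn s hs, hm s hs, ← EReal.coe_add]
  congr 1
  push_cast
  ring

theorem max (hh : IsPiecewiseAffine L h) (hk : IsPiecewiseAffine L k) :
    IsPiecewiseAffine L (fun s => Max.max (h s) (k s)) := by
  obtain ⟨B₁, hB₁⟩ := hh
  obtain ⟨B₂, hB₂⟩ := hk
  set B := B₁ ∪ B₂ with hBdef
  have hB : ∀ J : Set ℝ≥0, J.OrdConnected → (∀ s ∈ J, (s : ℝ≥0∞) ≤ L) → (∀ s ∈ J, s ∉ B) →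
      ∃ (a b c d : ℝ) (n m : ℤ), a = n ∧ c = m ∧
        ∀ s ∈ J, h s = ((a * s + b : ℝ) : EReal) ∧ k s = ((c * s + d : ℝ) : EReal) := by
    intro J h1 h2 h3
    obtain ⟨n, c, hn⟩ := hB₁ J h1 h2 (fun s hs hb => h3 s hs (Finset.mem_union_left _ hb))
    obtain ⟨m, d, hm⟩ := hB₂ J h1 h2 (fun s hs hb => h3 s hs (Finset.mem_union_right _ hb))
    exact ⟨n, c, m, d, n, m, rfl, rfl, fun s hs => ⟨hn s hs, hm s hs⟩⟩
  -- the isolated crossing points of the two functions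
  set C : Set ℝ≥0 := {s | h s = k s ∧ ∃ J : Set ℝ≥0, J.OrdConnected ∧
    (∀ s ∈ J, (s : ℝ≥0∞) ≤ L) ∧ (∀ s ∈ J, s ∉ B) ∧ s ∈ J ∧ ∃ t ∈ J, h t ≠ k t} with hC
  have hCB : ∀ s ∈ C, s ∉ B := by
    rintro s ⟨-, J, -, -, h3, hs, -⟩
    exact h3 s hs
  have key : ∀ s ∈ C, ∀ s' ∈ C, s < s' → B.filter (· < s) = B.filter (· < s') → False := by
    intro s hs s' hs' hlt hf
    have hsB := hCB s hs
    have hs'B := hCB s' hs'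
    obtain ⟨hsk, J, hJ, hJL, hJB, hsJ, t, htJ, ht⟩ := hs
    obtain ⟨hsk', J', hJ', hJL', hJB', hsJ', -⟩ := hs'
    have hI : ∀ u ∈ Set.Icc s s', u ∉ B := by
      rintro u ⟨hu1, hu2⟩ huB
      have hu2' : u < s' := lt_of_le_of_ne hu2 (fun h => hs'B (h ▸ huB))
      have : u ∈ B.filter (· < s) := by
        rw [hf]
        exact Finset.mem_filter.2 ⟨huB, hu2'⟩
      exact absurd (Finset.mem_filter.1 this).2 (not_lt.2 hu1)
    have hU : (J ∪ Set.Icc s s').OrdConnected := by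
      rw [Set.ordConnected_iff_uIcc_subset] at hJ ⊢
      intro a ha b hb u hu
      rw [Set.mem_uIcc] at hu
      have q1 : ∀ v ∈ J, ∀ w, (v ≤ w ∧ w ≤ s) ∨ (s ≤ w ∧ w ≤ v) → w ∈ J := fun v hv w hw =>
        hJ hv hsJ (Set.mem_uIcc.2 hw)
      rcases ha with ha | ha <;> rcases hb with hb | hb
      · exact Or.inl (hJ ha hb (Set.mem_uIcc.2 hu))
      · by_cases c1 : u ∈ Set.Icc s s'
        · exact Or.inr c1
        · left
          rw [Set.mem_Icc, not_and_or, not_le, not_le] at c1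
          rcases c1 with c1 | c1
          · rcases hu with ⟨d1, d2⟩ | ⟨d1, d2⟩
            · exact q1 a ha u (Or.inl ⟨d1, c1.le⟩)
            · exact absurd (hb.1.trans d1) (not_le.2 c1)
          · rcases hu with ⟨d1, d2⟩ | ⟨d1, d2⟩
            · exact absurd (d2.trans hb.2) (not_le.2 c1)
            · exact q1 a ha u (Or.inr ⟨hlt.le.trans c1.le, d2⟩)
      · by_cases c1 : u ∈ Set.Icc s s'
        · exact Or.inr c1
        · left
          rw [Set.mem_Icc, not_and_or, not_le, not_le] at c1
          rcases c1 with c1 | c1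
          · rcases hu with ⟨d1, d2⟩ | ⟨d1, d2⟩
            · exact absurd (ha.1.trans d1) (not_le.2 c1)
            · exact q1 b hb u (Or.inl ⟨d1, c1.le⟩)
          · rcases hu with ⟨d1, d2⟩ | ⟨d1, d2⟩
            · exact q1 b hb u (Or.inr ⟨hlt.le.trans c1.le, d2⟩)
            · exact absurd (d2.trans ha.2) (not_le.2 c1)
      · right
        rcases hu with ⟨d1, d2⟩ | ⟨d1, d2⟩
        · exact ⟨ha.1.trans d1, d2.trans hb.2⟩
        · exact ⟨hb.1.trans d1, d2.trans ha.2⟩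
    obtain ⟨a, b, c, d, -, -, -, -, hab⟩ := hB (J ∪ Set.Icc s s') hU
      (by
        rintro u (hu | hu)
        · exact hJL u hu
        · exact (ENNReal.coe_le_coe.2 hu.2).trans (hJL' s' hsJ'))
      (by
        rintro u (hu | hu)
        · exact hJB u hu
        · exact hI u hu)
    have e1 := hab s (Or.inl hsJ)
    have e2 := hab s' (Or.inr ⟨hlt.le, le_rfl⟩)
    have e3 := hab t (Or.inl htJ)
    rw [e1.1, e1.2, EReal.coe_eq_coe_iff] at hsk
    rw [e2.1, e2.2, EReal.coe_eq_coe_iff] at hsk'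
    apply ht
    rw [e3.1, e3.2, EReal.coe_eq_coe_iff]
    have hlt' : (s : ℝ) < s' := by exact_mod_cast hlt
    have hac : a = c := by
      have : (a - c) * ((s' : ℝ) - s) = 0 := by linear_combination hsk' - hsk
      rcases mul_eq_zero.1 this with h0 | h0 <;> linarith
    subst hac
    linarith
  have hCfin : C.Finite := by
    refine Set.Finite.of_finite_image (f := fun s => B.filter (· < s))
      (B.powerset.finite_toSet.subset ?_) ?_
    · rintro _ ⟨s, -, rfl⟩
      exact Finset.mem_coe.2 (Finset.mem_powerset.2 (Finset.filter_subset _ _))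
    · intro s hs s' hs' hf
      rcases lt_trichotomy s s' with h1 | h1 | h1
      · exact (key s hs s' hs' h1 hf).elim
      · exact h1
      · exact (key s' hs' s hs h1 hf.symm).elim
  refine ⟨B ∪ hCfin.toFinset, fun J h1 h2 h3 => ?_⟩
  have h3B : ∀ s ∈ J, s ∉ B := fun s hs hb => h3 s hs (Finset.mem_union_left _ hb)
  have h3C : ∀ s ∈ J, s ∉ C := fun s hs hb =>
    h3 s hs (Finset.mem_union_right _ (hCfin.mem_toFinset.2 hb))
  obtain ⟨a, b, c, d, n, m, rfl, rfl, hab⟩ := hB J h1 h2 h3B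
  by_cases hex : ∃ s ∈ J, h s = k s
  · obtain ⟨s, hs, hsk⟩ := hex
    have heq : ∀ t ∈ J, h t = k t := by
      intro t ht
      by_contra hne
      exact h3C s hs ⟨hsk, J, h1, h2, h3B, hs, t, ht, hne⟩
    exact ⟨n, b, fun t ht => by
      change Max.max (h t) (k t) = _
      rw [← heq t ht, max_self, (hab t ht).1]⟩
  push Not at hex
  have hcross : ∀ u ∈ J, ∀ v ∈ J, (n * u + b : ℝ) < m * u + d → (m * v + d : ℝ) < n * v + b →
      False := by
    intro u hu v hv hu' hv'
    have hcont : ContinuousOn (fun s : ℝ≥0 => ((n * s + b : ℝ) - (m * s + d))) J := by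
      fun_prop
    have := h1.isPreconnected.intermediate_value hu hv hcont
    obtain ⟨w, hw, hw0⟩ := this (show (0 : ℝ) ∈ Set.Icc _ _ from ⟨by linarith, by linarith⟩)
    refine hex w hw ?_
    rw [(hab w hw).1, (hab w hw).2, EReal.coe_eq_coe_iff]
    linarith
  have hne : ∀ u ∈ J, (n * u + b : ℝ) ≠ m * u + d := by
    intro u hu hh
    exact hex u hu (by rw [(hab u hu).1, (hab u hu).2, hh])
  by_cases hlt : ∃ u ∈ J, (n * u + b : ℝ) < m * u + d
  · obtain ⟨u, hu, hu'⟩ := hlt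
    refine ⟨m, d, fun v hv => ?_⟩
    change Max.max (h v) (k v) = _
    rw [(hab v hv).1, (hab v hv).2, max_eq_right]
    rw [EReal.coe_le_coe_iff]
    exact not_lt.1 fun hv' => hcross u hu v hv hu' hv'
  · push Not at hlt
    refine ⟨n, b, fun v hv => ?_⟩
    change Max.max (h v) (k v) = _
    rw [(hab v hv).1, (hab v hv).2, max_eq_left]
    rw [EReal.coe_le_coe_iff]
    exact hlt v hv

/-- A piecewise affine function on a ray has a limit at infinity. -/
theorem exists_tendsto (hh : IsPiecewiseAffine ∞ h) :
    ∃ y, Filter.Tendsto h Filter.atTop (𝓝 y) := by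
  obtain ⟨B, hB⟩ := hh
  set a := B.sup id with ha
  obtain ⟨n, c, hn⟩ := hB (Set.Ioi a) Set.ordConnected_Ioi (by simp) (by
    intro s hs hb
    exact absurd (Finset.le_sup (f := id) hb) (not_le.2 hs))
  have hev : (fun s : ℝ≥0 => ((n * s + c : ℝ) : EReal)) =ᶠ[Filter.atTop] h := by
    filter_upwards [Filter.Ioi_mem_atTop a] with s hs
    exact (hn s hs).symm
  have hcoe : Filter.Tendsto (fun s : ℝ≥0 => (s : ℝ)) Filter.atTop Filter.atTop :=
    NNReal.tendsto_coe_atTop.2 Filter.tendsto_id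
  rcases lt_trichotomy (n : ℝ) 0 with h0 | h0 | h0
  · refine ⟨⊥, Filter.Tendsto.congr' hev (EReal.tendsto_coe_nhds_bot_iff.2 ?_)⟩
    exact Filter.tendsto_atBot_add_const_right _ _ (hcoe.const_mul_atTop_of_neg h0)
  · refine ⟨(c : EReal), Filter.Tendsto.congr' hev ?_⟩
    simp [h0]
  · refine ⟨⊤, Filter.Tendsto.congr' hev (EReal.tendsto_coe_nhds_top_iff.2 ?_)⟩
    exact Filter.tendsto_atTop_add_const_right _ _ (hcoe.const_mul_atTop h0)

end IsPiecewiseAffine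

namespace RatFun

variable {Γ : Type*} [TopologicalSpace Γ] [EDist Γ]

instance : CoeFun (RatFun Γ) (fun _ => Γ → EReal) := ⟨RatFun.toFun⟩

theorem ext_fun {f g : RatFun Γ} (h : ∀ x, f x = g x) : f = g := by
  cases f
  cases g
  congr
  exact funext h

theorem cont (f : RatFun Γ) : Continuous (f : Γ → EReal) := f.2.1

/-- The rational function `-∞`, which is the zero element. -/
noncomputable instance : Zero (RatFun Γ) := ⟨⟨fun _ => ⊥, continuous_const, Or.inl fun _ => rfl⟩⟩

/-- The constant function `0`, which is the identity element. -/
noncomputable instance : One (RatFun Γ) :=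
  ⟨⟨fun _ => 0, continuous_const, Or.inr ⟨fun _ _ => by simp, fun _ _ =>
    IsPiecewiseAffine.const 0⟩⟩⟩

@[simp] theorem zero_apply (x : Γ) : (0 : RatFun Γ) x = ⊥ := rfl

@[simp] theorem one_apply (x : Γ) : (1 : RatFun Γ) x = 0 := rfl

theorem prop_of_ne {f : RatFun Γ} (hf : f ≠ 0) :
    (∀ x ∉ pointsAtInfinity Γ, f x ≠ ⊥ ∧ f x ≠ ⊤) ∧
      ∀ (M : TropicalModel Γ) (e : M.Edge),
        IsPiecewiseAffine (M.len e) (fun s => f (M.chart e s)) :=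
  f.2.2.resolve_left fun h => hf (ext_fun h)

theorem ne_top (f : RatFun Γ) {x : Γ} (hx : x ∉ pointsAtInfinity Γ) : f x ≠ ⊤ := by
  by_cases hf : f = 0
  · simp [hf]
  · exact ((prop_of_ne hf).1 x hx).2

/-- The tropical sum `f ⊕ g`, the pointwise maximum. -/
noncomputable instance : Add (RatFun Γ) :=
  ⟨fun f g => ⟨fun x => max (f x) (g x), f.cont.max g.cont, by
    by_cases hf : f = 0
    · simpa [hf] using g.2.2
    by_cases hg : g = 0
    · simpa [hg] using f.2.2
    obtain ⟨f1, f2⟩ := prop_of_ne hf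
    obtain ⟨g1, g2⟩ := prop_of_ne hg
    refine Or.inr ⟨fun x hx => ⟨?_, ?_⟩, fun M e => (f2 M e).max (g2 M e)⟩
    · exact (lt_max_of_lt_left (bot_lt_iff_ne_bot.2 (f1 x hx).1)).ne'
    · exact (max_lt (lt_top_iff_ne_top.2 (f1 x hx).2) (lt_top_iff_ne_top.2 (g1 x hx).2)).ne⟩⟩

@[simp] theorem add_apply (f g : RatFun Γ) (x : Γ) : (f + g) x = max (f x) (g x) := rfl

theorem tendsto_add {f g : RatFun Γ} {x : Γ} (hf : f x ≠ ⊥ ∧ f x ≠ ⊤) (A : Set Γ) :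
    Filter.Tendsto (fun y => f y + g y) (𝓝[A] x) (𝓝 (f x + g x)) := by
  have h1 : ContinuousAt (fun p : EReal × EReal => p.1 + p.2) (f x, g x) :=
    EReal.continuousAt_add (Or.inl hf.2) (Or.inl hf.1)
  have h2 : Filter.Tendsto (fun y => (f y, g y)) (𝓝[A] x) (𝓝 (f x, g x)) :=
    ((f.cont.prodMk g.cont).tendsto x).mono_left nhdsWithin_le_nhds
  exact h1.tendsto.comp h2

open Classical in
/-- The multiplicative inverse, `-f` for `f ≠ -∞`. -/
noncomputable instance : Inv (RatFun Γ) :=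
  ⟨fun f => if h : f = 0 then 0 else
    ⟨fun x => - f x, f.cont.neg, Or.inr ⟨fun x hx => by
      simpa [and_comm] using (prop_of_ne h).1 x hx, fun M e => ((prop_of_ne h).2 M e).neg⟩⟩⟩

theorem inv_zero_aux : (0 : RatFun Γ)⁻¹ = 0 := dif_pos rfl

theorem inv_apply {f : RatFun Γ} (hf : f ≠ 0) (x : Γ) : f⁻¹ x = - f x := by
  have h' : f⁻¹ = _ := dif_neg hf
  rw [h']

variable [IsTropicalCurve Γ]

theorem dense_finite : Dense ((pointsAtInfinity Γ)ᶜ : Set Γ) :=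
  (IsTropicalCurve.exists_model (Γ := Γ)).some.dense_finite

theorem ext_finite {f g : RatFun Γ} (h : ∀ x ∉ pointsAtInfinity Γ, f x = g x) : f = g :=
  ext_fun (congrFun (Continuous.ext_on dense_finite f.cont g.cont h))

theorem exists_tendsto_add {f g : RatFun Γ} (hf : f ≠ 0) (hg : g ≠ 0) (x : Γ) :
    ∃ y, Filter.Tendsto (fun z => f z + g z) (𝓝[(pointsAtInfinity Γ)ᶜ] x) (𝓝 y) := by
  by_cases hx : x ∈ pointsAtInfinity Γ
  · obtain ⟨M, e, he, rfl⟩ := hx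
    obtain ⟨y, hy⟩ := (he ▸ ((prop_of_ne hf).2 M e).add ((prop_of_ne hg).2 M e) :
      IsPiecewiseAffine ∞ _).exists_tendsto
    exact ⟨y, (Filter.tendsto_map'_iff.2 hy).mono_left (M.nhds_infinity he)⟩
  · exact ⟨_, tendsto_add ((prop_of_ne hf).1 x hx) _⟩

open Classical in
/-- The tropical product `f ⊙ g`, the pointwise sum outside the points at infinity, extended to the
points at infinity by continuity. -/
noncomputable instance : Mul (RatFun Γ) :=
  ⟨fun f g => if h : f = 0 ∨ g = 0 then 0 else
    ⟨extendFrom (pointsAtInfinity Γ)ᶜ (fun x => f x + g x), by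
      rw [not_or] at h
      obtain ⟨f1, f2⟩ := prop_of_ne h.1
      obtain ⟨g1, g2⟩ := prop_of_ne h.2
      have hval : ∀ x ∉ pointsAtInfinity Γ,
          extendFrom (pointsAtInfinity Γ)ᶜ (fun x => f x + g x) x = f x + g x := fun x hx =>
        extendFrom_eq (dense_finite x) (tendsto_add (f1 x hx) _)
      refine ⟨continuous_extendFrom dense_finite (exists_tendsto_add h.1 h.2), Or.inr ⟨?_, ?_⟩⟩
      · intro x hx
        rw [hval x hx]
        lift f x to ℝ using ⟨(f1 x hx).2, (f1 x hx).1⟩ with a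
        lift g x to ℝ using ⟨(g1 x hx).2, (g1 x hx).1⟩ with b
        rw [← EReal.coe_add]
        exact ⟨EReal.coe_ne_bot _, EReal.coe_ne_top _⟩
      · intro M e
        exact ((f2 M e).add (g2 M e)).congr fun s hs =>
          hval _ (M.chart_not_mem_infinity hs (by simp))⟩⟩

theorem mul_apply_of_ne (f g : RatFun Γ) {x : Γ} (hf : f x ≠ ⊥ ∧ f x ≠ ⊤) (hg : g x ≠ ⊥) :
    (f * g) x = f x + g x := by
  have h : ¬ (f = 0 ∨ g = 0) := by
    rintro (rfl | rfl)
    · exact hf.1 rfl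
    · exact hg rfl
  have h' : f * g = _ := dif_neg h
  rw [h']
  exact extendFrom_eq (dense_finite x) (tendsto_add hf _)

@[simp] theorem zero_mul_aux (f : RatFun Γ) : 0 * f = 0 := dif_pos (Or.inl rfl)

@[simp] theorem mul_zero_aux (f : RatFun Γ) : f * 0 = 0 := dif_pos (Or.inr rfl)

/-- Outside the points at infinity, the product is the sum of the values. -/
theorem mul_apply (f g : RatFun Γ) {x : Γ} (hx : x ∉ pointsAtInfinity Γ) :
    (f * g) x = f x + g x := by
  by_cases hf : f = 0
  · simp [hf]
  by_cases hg : g = 0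
  · simp [hg]
  exact mul_apply_of_ne f g ((prop_of_ne hf).1 x hx) ((prop_of_ne hg).1 x hx).1

/-- `Rat(Γ)` is a semifield. -/
noncomputable instance : Semifield (RatFun Γ) where
  add_assoc f g h := ext_finite fun x _ => by simp [max_assoc]
  zero_add f := ext_finite fun x _ => by simp
  add_zero f := ext_finite fun x _ => by simp
  add_comm f g := ext_finite fun x _ => by simp [max_comm]
  nsmul := nsmulRec
  mul_assoc f g h := ext_finite fun x hx => by simp [mul_apply _ _ hx, add_assoc]
  one_mul f := ext_finite fun x hx => by simp [mul_apply _ _ hx]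
  mul_one f := ext_finite fun x hx => by simp [mul_apply _ _ hx]
  mul_comm f g := ext_finite fun x hx => by simp [mul_apply _ _ hx, add_comm]
  zero_mul := zero_mul_aux
  mul_zero := mul_zero_aux
  left_distrib f g h := ext_finite fun x hx => by
    simp [mul_apply _ _ hx, max_add_add_left]
  right_distrib f g h := ext_finite fun x hx => by
    simp [mul_apply _ _ hx, max_add_add_right]
  exists_pair_ne := ⟨0, 1, fun h => by
    obtain ⟨x⟩ : Nonempty Γ := inferInstance
    have : (0 : RatFun Γ) x = (1 : RatFun Γ) x := by rw [h]
    simp at this⟩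
  mul_inv_cancel f hf := ext_finite fun x hx => by
    have h := (prop_of_ne hf).1 x hx
    rw [mul_apply _ _ hx, inv_apply hf, one_apply]
    lift f x to ℝ using ⟨h.2, h.1⟩ with a
    rw [← EReal.coe_neg, ← EReal.coe_add]
    simp
  inv_zero := inv_zero_aux
  nnqsmul := _
  nnqsmul_def := fun _ _ => rfl

end RatFun

/-- A subsemifield of a semifield `T`; a semifield extension `T / S` is given by a subsemifield. -/
structure Subsemifield (T : Type*) [Semifield T] extends Subsemiring T where
  inv_mem' : ∀ {a : T}, a ∈ carrier → a⁻¹ ∈ carrier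

/-- The subsemifield `T^H` of the elements fixed by all elements of the subgroup `H`. -/
def invariantSubsemifield {G T : Type*} [Group G] [Semifield T] [MulSemiringAction G T]
    (H : Subgroup G) : Subsemifield T where
  carrier := {t | ∀ h ∈ H, h • t = t}
  mul_mem' ha hb h hh := by rw [smul_mul', ha h hh, hb h hh]
  one_mem' h _ := smul_one h
  add_mem' ha hb h hh := by rw [smul_add, ha h hh, hb h hh]
  zero_mem' h _ := smul_zero h
  inv_mem' {a} ha h hh := by
    by_cases ha0 : a = 0
    · rw [ha0, inv_zero, smul_zero]
    · refine eq_inv_of_mul_eq_one_left ?_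
      nth_rewrite 2 [← ha h hh]
      rw [← smul_mul', inv_mul_cancel₀ ha0, smul_one]

/-- The action of `G` on `T` is Galois for `T / S`: `T^G = S`, and subgroups of `G` whose invariant
semifields coincide are equal. -/
def IsGaloisAction (G : Type*) {T : Type*} [Group G] [Semifield T] [MulSemiringAction G T]
    (S : Subsemifield T) : Prop :=
  invariantSubsemifield (⊤ : Subgroup G) = S ∧
    ∀ H₁ H₂ : Subgroup G, (invariantSubsemifield H₁ : Subsemifield T) = invariantSubsemifield H₂ →
      H₁ = H₂

/-- `G` isometrically acts on `Γ`: it acts by continuous maps, and isometrically outside the points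
at infinity. -/
class IsIsometricAction (G Γ : Type*) [Group G] [TopologicalSpace Γ] [EDist Γ] [MulAction G Γ] :
    Prop extends ContinuousConstSMul G Γ where
  edist_smul : ∀ (g : G) (x y : Γ), x ∉ pointsAtInfinity Γ → y ∉ pointsAtInfinity Γ →
    edist (g • x) (g • y) = edist x y

namespace IsIsometricAction

variable {G Γ : Type*} [Group G] [TopologicalSpace Γ] [EDist Γ] [IsTropicalCurve Γ]
  [MulAction G Γ] [IsIsometricAction G Γ]

theorem smul_not_mem (g : G) {x : Γ} (hx : x ∉ pointsAtInfinity Γ) :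
    g • x ∉ pointsAtInfinity Γ := by
  rintro ⟨N, e, he, h⟩
  obtain ⟨M⟩ := IsTropicalCurve.exists_model (Γ := Γ)
  have : Nontrivial Γ := ⟨⟨N.chart e 0, N.chart e ∞, fun h => by
    have := (N.leaf e he e 0 (zero_le) h).2
    simp at this⟩⟩
  obtain ⟨y, hy, hy', hd⟩ := M.exists_near (x := x) fun e he h => hx ⟨M, e, he, h⟩
  have hy2 : y ∉ pointsAtInfinity Γ := by
    rw [M.mem_pointsAtInfinity_iff]
    rintro ⟨e, he, h⟩
    exact hy' e he h
  rw [← edist_smul g x y hx hy2, ← h] at hd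
  exact hd (N.edist_top_left he fun h2 => hy (MulAction.injective g (h2.trans h)))

theorem smul_mem_iff (g : G) {x : Γ} : g • x ∈ pointsAtInfinity Γ ↔ x ∈ pointsAtInfinity Γ := by
  constructor
  · intro h
    by_contra hx
    exact smul_not_mem g hx h
  · intro h
    by_contra hx
    have := smul_not_mem g⁻¹ hx
    rw [inv_smul_smul] at this
    exact this h

theorem edist_smul_smul (g : G) (x y : Γ) : edist (g • x) (g • y) = edist x y := by
  obtain ⟨M⟩ := IsTropicalCurve.exists_model (Γ := Γ)
  by_cases hxy : x = y
  · rw [hxy, M.edist_self, M.edist_self]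
  have hxy' : g • x ≠ g • y := fun h => hxy (MulAction.injective g h)
  by_cases hx : x ∈ pointsAtInfinity Γ
  · obtain ⟨N, e, he, h⟩ := (smul_mem_iff g).2 hx
    obtain ⟨N', e', he', h'⟩ := hx
    rw [← h, N.edist_top_left he (by rw [h]; exact hxy'.symm), ← h',
      N'.edist_top_left he' (by rw [h']; exact Ne.symm hxy)]
  by_cases hy : y ∈ pointsAtInfinity Γ
  · obtain ⟨N, e, he, h⟩ := (smul_mem_iff g).2 hy
    obtain ⟨N', e', he', h'⟩ := hy
    rw [← h, N.edist_top_right he (by rw [h]; exact hxy'), ← h',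
      N'.edist_top_right he' (by rw [h']; exact hxy)]
  exact edist_smul g x y hx hy

end IsIsometricAction

namespace RatFun

section Action

variable {G Γ : Type*} [Group G] [TopologicalSpace Γ] [EDist Γ] [IsTropicalCurve Γ]
  [MulAction G Γ] [IsIsometricAction G Γ]

/-- The natural action on rational functions: `(g • f)(x) = f(g⁻¹ • x)`. -/
instance : SMul G (RatFun Γ) :=
  ⟨fun g f => ⟨fun x => f (g⁻¹ • x), f.cont.comp (continuous_const_smul g⁻¹), by
    rcases f.2.2 with h | ⟨h1, h2⟩
    · exact Or.inl fun x => h _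
    · exact Or.inr ⟨fun x hx => h1 _ (IsIsometricAction.smul_not_mem g⁻¹ hx), fun M e =>
        h2 (M.map (Homeomorph.smul g⁻¹) (IsIsometricAction.edist_smul_smul g⁻¹)) e⟩⟩⟩

@[simp] theorem smul_apply (g : G) (f : RatFun Γ) (x : Γ) : (g • f) x = f (g⁻¹ • x) := rfl

noncomputable instance : MulSemiringAction G (RatFun Γ) where
  one_smul f := ext_finite fun x _ => by simp
  mul_smul g h f := ext_finite fun x _ => by simp [mul_smul]
  smul_zero g := ext_finite fun x _ => by simp
  smul_add g f h := ext_finite fun x _ => by simp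
  smul_one g := ext_finite fun x _ => by simp
  smul_mul g f h := ext_finite fun x hx => by
    rw [mul_apply _ _ hx, smul_apply, mul_apply _ _ (IsIsometricAction.smul_not_mem g⁻¹ hx)]
    rfl

end Action

section Pullback

variable {Γ Γ' : Type*} [TopologicalSpace Γ] [EDist Γ] [IsTropicalCurve Γ]
  [TopologicalSpace Γ'] [EDist Γ'] [IsTropicalCurve Γ']

/-- `φ^*(Rat(Γ'))`, the set of the pull-backs `f' ∘ φ` of rational functions `f'` on `Γ'`. -/
def pullback (φ : C(Γ, Γ')) : Subsemifield (RatFun Γ) where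
  carrier := {f | ∃ f' : RatFun Γ', ∀ x, f x = f' (φ x)}
  mul_mem' := by
    rintro f g ⟨f', hf⟩ ⟨g', hg⟩
    by_cases hf0 : f = 0
    · exact ⟨0, fun x => by simp [hf0]⟩
    by_cases hg0 : g = 0
    · exact ⟨0, fun x => by simp [hg0]⟩
    refine ⟨f' * g', fun x => ?_⟩
    refine congrFun (Continuous.ext_on dense_finite (f * g).cont
      ((f' * g').cont.comp φ.continuous) fun y hy => ?_) x
    have h1 := (prop_of_ne hf0).1 y hy
    have h2 := (prop_of_ne hg0).1 y hy
    rw [Function.comp_apply, mul_apply _ _ hy, hf y, hg y]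
    rw [hf y] at h1
    rw [hg y] at h2
    exact (mul_apply_of_ne f' g' h1 h2.1).symm
  one_mem' := ⟨1, fun _ => rfl⟩
  add_mem' := by
    rintro f g ⟨f', hf⟩ ⟨g', hg⟩
    exact ⟨f' + g', fun x => by simp [hf x, hg x]⟩
  zero_mem' := ⟨0, fun _ => rfl⟩
  inv_mem' := by
    rintro f ⟨f', hf⟩
    by_cases hf0 : f = 0
    · exact ⟨0, fun x => by simp [hf0]⟩
    have hf0' : f' ≠ 0 := by
      rintro rfl
      exact hf0 (ext_finite fun x _ => by simp [hf x])
    exact ⟨f'⁻¹, fun x => by rw [inv_apply hf0, inv_apply hf0', hf x]⟩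

end Pullback

end RatFun

/-- A finite harmonic morphism between tropical curves. With respect to suitable loopless models,
`φ` maps vertices to vertices and each edge `e` onto an edge `onEdge e`, it stretches distances on
`e` by the factor `deg e`, and for every vertex `v` the sum of the degrees of the edges at `v` over
an edge `e'` at `φ v` does not depend on `e'`. -/
def IsFiniteHarmonic {Γ Γ' : Type*} [TopologicalSpace Γ] [EDist Γ] [TopologicalSpace Γ']
    [EDist Γ'] (φ : C(Γ, Γ')) : Prop :=
  ∃ (M : TropicalModel Γ) (M' : TropicalModel Γ') (onEdge : M.Edge → M'.Edge) (deg : M.Edge → ℕ),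
    M.Loopless ∧ M'.Loopless ∧
    (∀ v ∈ M.verts, φ v ∈ M'.verts) ∧
    (∀ e, φ '' M.edgeSet e = M'.edgeSet (onEdge e)) ∧
    (∀ e, 0 < deg e) ∧
    (∀ e, ∀ x ∈ M.edgeSet e, ∀ y ∈ M.edgeSet e, edist (φ x) (φ y) = deg e * edist x y) ∧
    (∀ v ∈ M.verts, ∃ m : ℕ, ∀ e' : M'.Edge, φ v ∈ M'.edgeSet e' →
      ∑ᶠ (e : M.Edge) (_ : onEdge e = e' ∧ v ∈ M.edgeSet e), deg e = m)

/-! Both conditions contain the equality `Rat(Γ)^G = φ^*(Rat(Γ'))`, so the content is that every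
subgroup of `G` is a stabilizer exactly when `H ↦ T^H` is injective, where `T = Rat(Γ)`.

If `H₁` is the stabilizer of `a`, then `a` lies in `T^H₁`. When `T^H₁ = T^H₂`, the element `a` is
fixed by `H₂` as well, so `H₂ ≤ H₁`; exchanging the roles gives equality
(`eq_of_invariantSubsemifield_eq`).

Conversely, suppose that `H` is not a stabilizer. Each element of `T^H` is then fixed by some `K >
H`, so the multiplicative group of `T^H` is a union of the multiplicative groups of the `T^K`,
finitely many because `G` is finite. By B. H. Neumann's covering lemma one of these has finite
index, so each nonzero `a` in `T^H` has a power `a ^ n`, `n > 0`, fixed by `K`. For `k` in `K`, both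
`k • a` and `a` are `n`-th roots of `a ^ n`. Roots in `T` are unique, so `k • a = a` and `T^H = T^K`
(`invariantSubsemifield_eq_of_relIndex_ne_zero`), which contradicts injectivity. Uniqueness of roots
in `Rat(Γ)` is division by `n` in `ℝ`, since tropical powers are multiples of real values away from
`Γ_∞`. -/

/-! ### Multiplicative groups of subsemifields -/

namespace Subsemifield

variable {T : Type*} [Semifield T]

theorem ext_carrier {S S' : Subsemifield T} (h : ∀ a, a ∈ S.carrier ↔ a ∈ S'.carrier) :
    S = S' := by
  obtain ⟨S, hS⟩ := S
  obtain ⟨S', hS'⟩ := S'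
  obtain rfl : S = S' := Subsemiring.ext h
  rfl

/-- The group of nonzero elements of a subsemifield. -/
def unitSubgroup (S : Subsemifield T) : Subgroup Tˣ where
  carrier := {u | (u : T) ∈ S.carrier}
  mul_mem' ha hb := S.mul_mem' ha hb
  one_mem' := S.one_mem'
  inv_mem' {u} hu := by
    change ((u⁻¹ : Tˣ) : T) ∈ S.carrier
    rw [Units.val_inv_eq_inv_val]
    exact S.inv_mem' hu

theorem mem_unitSubgroup {S : Subsemifield T} {u : Tˣ} :
    u ∈ S.unitSubgroup ↔ (u : T) ∈ S.carrier :=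
  Iff.rfl

end Subsemifield

/-! ### Invariants and stabilizers for a group acting on a semifield -/

section Invariants

variable {G T : Type*} [Group G] [Semifield T] [MulSemiringAction G T]

/-- This is the adjunction between subgroups and fixed elements. It lets both directions be argued
with inclusions of stabilizers. -/
theorem mem_invariantSubsemifield_iff {H : Subgroup G} {a : T} :
    a ∈ (invariantSubsemifield H : Subsemifield T).carrier ↔ H ≤ MulAction.stabilizer G a :=
  Iff.rfl

/-- If `K` contains `H` and the units of `T^K` have finite index in those of `T^H`, then
`T^K = T^H`, provided that `T` has unique roots. -/
theorem invariantSubsemifield_eq_of_relIndex_ne_zero [IsMulTorsionFree T] {H K : Subgroup G}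
    (hHK : H ≤ K)
    (h : (invariantSubsemifield K : Subsemifield T).unitSubgroup.relIndex
      (invariantSubsemifield H : Subsemifield T).unitSubgroup ≠ 0) :
    (invariantSubsemifield H : Subsemifield T) = invariantSubsemifield K := by
  refine Subsemifield.ext_carrier fun a => ⟨fun ha k hk => ?_, fun ha h hh => ha h (hHK hh)⟩
  -- Zero is outside the unit groups, but every group element fixes it, so passing to units loses
  -- nothing.
  rcases eq_or_ne a 0 with rfl | ha0
  · exact smul_zero k
  -- A relative index is nonzero exactly when it is finite, so some positive power of `a` lands in
  -- the units of `T^K`.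
  obtain ⟨n, hn, -, hmem⟩ := Subgroup.exists_pow_mem_of_relIndex_ne_zero h
    (a := Units.mk0 a ha0) (Subsemifield.mem_unitSubgroup.2 ha)
  have hpow : k • a ^ n = a ^ n := by
    simpa using (Subsemifield.mem_unitSubgroup.1 hmem.1) k hk
  -- The action is multiplicative, so `k • a` and `a` have the same `n`-th power; unique roots
  -- identify them.
  refine pow_left_injective hn.ne' ?_
  simpa only [smul_pow'] using hpow

open scoped Pointwise in
/-- For a finite group acting on a semifield with unique roots, if distinct subgroups have distinct
invariants, then every subgroup is the stabilizer of an element. -/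
theorem exists_stabilizer_eq_of_injective [Finite G] [IsMulTorsionFree T]
    (hinj : ∀ H₁ H₂ : Subgroup G,
      (invariantSubsemifield H₁ : Subsemifield T) = invariantSubsemifield H₂ → H₁ = H₂)
    (H : Subgroup G) : ∃ a : T, MulAction.stabilizer G a = H := by
  by_contra! hne
  set A := (invariantSubsemifield H : Subsemifield T).unitSubgroup
  -- The covering lemma concerns left cosets of subgroups of one ambient group: hence the
  -- restriction to `A` and the trivial translates by `1`.
  have hcover : ⋃ K ∈ (Set.toFinite (Set.Ioi H)).toFinset, (1 : A) •
      (((invariantSubsemifield K : Subsemifield T).unitSubgroup.subgroupOf A : Subgroup A) :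
        Set A) = Set.univ := by
    refine Set.eq_univ_of_forall fun u => ?_
    have hu : H ≤ MulAction.stabilizer G ((u : Tˣ) : T) := u.2
    -- The stabilizer of `u` itself serves as `K`: it contains `H` because `u` is `H`-invariant, and
    -- it differs from `H` by assumption.
    refine Set.mem_biUnion (x := MulAction.stabilizer G ((u : Tˣ) : T)) ?_ ?_
    · simpa using lt_of_le_of_ne hu (hne _).symm
    · rw [one_smul]
      exact mem_invariantSubsemifield_iff.2 le_rfl
  -- Neumann's lemma: in a finite cover of a group by cosets, some subgroup involved has finite
  -- index.
  obtain ⟨K, hK, hfin⟩ := Subgroup.exists_finiteIndex_of_leftCoset_cover hcover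
  have hHK : H < K := by simpa using hK
  exact hHK.ne (hinj H K (invariantSubsemifield_eq_of_relIndex_ne_zero hHK.le hfin.index_ne_zero))

/-- If every subgroup is the stabilizer of an element, then distinct subgroups have distinct
invariants. -/
theorem eq_of_invariantSubsemifield_eq
    (hstab : ∀ H : Subgroup G, ∃ a : T, MulAction.stabilizer G a = H) {H₁ H₂ : Subgroup G}
    (h : (invariantSubsemifield H₁ : Subsemifield T) = invariantSubsemifield H₂) : H₁ = H₂ := by
  have key : ∀ {K₁ K₂ : Subgroup G},
      (invariantSubsemifield K₁ : Subsemifield T) = invariantSubsemifield K₂ → K₂ ≤ K₁ := by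
    intro K₁ K₂ hK
    -- With `K₁` equal to the stabilizer of `a`, the goal says that `a` is `K₂`-invariant, which
    -- transfers from `K₁` through `hK`.
    obtain ⟨a, rfl⟩ := hstab K₁
    refine mem_invariantSubsemifield_iff.1 ?_
    rw [← hK]
    exact mem_invariantSubsemifield_iff.2 le_rfl
  exact le_antisymm (key h.symm) (key h)

end Invariants

/-! ### Uniqueness of roots in `Rat(Γ)` -/

namespace RatFun

variable {Γ : Type*} [TopologicalSpace Γ] [EDist Γ] [IsTropicalCurve Γ]

theorem pow_apply (f : RatFun Γ) (n : ℕ) {x : Γ} (hx : x ∉ pointsAtInfinity Γ) :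
    (f ^ n) x = n • f x := by
  induction n with
  | zero => simp
  | succ n ih => rw [pow_succ, mul_apply _ _ hx, ih, succ_nsmul]

/-- Off `Γ_∞` a nonzero rational function is real-valued and its `n`-th power is `n` times it, so
the power determines the function there; continuity and density of the finite points extend the
equality to `Γ_∞`. The function `-∞` is treated separately, as the only element with a vanishing
positive power. -/
instance : IsMulTorsionFree (RatFun Γ) where
  pow_left_injective n hn f g (h : f ^ n = g ^ n) := by
    rcases eq_or_ne f 0 with rfl | hf
    · exact (eq_zero_of_pow_eq_zero (h.symm.trans (zero_pow hn))).symm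
    rcases eq_or_ne g 0 with rfl | hg
    · exact eq_zero_of_pow_eq_zero (h.trans (zero_pow hn))
    refine ext_finite fun x hx => ?_
    have hfx := (prop_of_ne hf).1 x hx
    have hgx := (prop_of_ne hg).1 x hx
    have hpow : n • f x = n • g x := by rw [← pow_apply f n hx, h, pow_apply g n hx]
    lift f x to ℝ using ⟨hfx.2, hfx.1⟩ with a
    lift g x to ℝ using ⟨hgx.2, hgx.1⟩ with b
    rw [← EReal.coe_nsmul, ← EReal.coe_nsmul, EReal.coe_eq_coe_iff] at hpow
    rw [nsmul_right_injective hn hpow]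

end RatFun

theorem mainTheorem7 {Γ Γ' G : Type*}
    [TopologicalSpace Γ] [EDist Γ] [IsTropicalCurve Γ]
    [TopologicalSpace Γ'] [EDist Γ'] [IsTropicalCurve Γ']
    (φ : C(Γ, Γ')) (hφ : IsFiniteHarmonic φ)
    [Group G] [Finite G] [MulAction G Γ] [IsIsometricAction G Γ] :
    ((invariantSubsemifield (⊤ : Subgroup G) : Subsemifield (RatFun Γ)) = RatFun.pullback φ ∧
      ∀ H : Subgroup G, ∃ f : RatFun Γ, MulAction.stabilizer G f = H) ↔
    IsGaloisAction G (RatFun.pullback φ) :=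
  -- The first conjunct is the same on both sides, so only the conditions on subgroups need
  -- comparing.
  and_congr_right fun _ => ⟨fun h _ _ => eq_of_invariantSubsemifield_eq h,
    exists_stabilizer_eq_of_injective⟩
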